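/- Let $\ell \ge 3$ be an integer. Write $(a,b)$ for the position in row $a$ and column $b$ of a Young diagram (English notation, $a,b\ge 1$); its residue is $b-a \bmod \ell$. The hook length $h^\lambda_{(a,b)}$ of a box $(a,b)$ of a partition $\lambda$ is the number of boxes of $\lambda$ that lie to its right in row $a$ or below it in column $b$, including the box itself. A partition $\lambda$ is an $(\ell,0)$-JM partition if there are no boxes $(a,b),(a,y),(x,b)$ of $\lambda$ with $\ell\mid h^\lambda_{(a,b)}$, $\ell\nmid h^\lambda_{(a,y)}$ and $\ell\nmid h^\lambda_{(x,b)}$. For $k\ge 1$ the $k$-th ladder is the set of positions $(a,b)$ with $a+(\ell-1)(b-1)=k$; all its positions have the same residue, and ladders are ordered from left to right by increasing $k$. For a residue $i\in\mathbb Z/\ell\mathbb Z$, the ladder $i$-signature of $\lambda$ is the word with one letter $+$ for every addable box of $\lambda$ of residue $i$ and one letter $-$ for every removable box of $\lambda$ of residue $i$, where the ladders are read from left to right and each ladder from top to bottom. Cancelling adjacent pairs $-+$ as long as possible gives a reduced word of the form $+\cdots+-\cdots-$. If the reduced word contains a $+$, then $\widehat f_i\lambda$ is $\lambda$ together with the box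 of the rightmost $+$ of the reduced word; otherwise $\widehat f_i\lambda=0$. The nodes of the ladder crystal $B(\Lambda_0)^L$ are the partitions obtained from the empty partition $\emptyset$ by applying finitely many operators $\widehat f_i$, $i\in\mathbb Z/\ell\mathbb Z$. Theorem. Every $(\ell,0)$-JM partition is a node of $B(\Lambda_0)^L$. -/

import Mathlib

/-! Partitions are Young diagrams in English notation; boxes `(a, b)` are (row, column), numbered
from `0`.  Passing between this and numbering from `1` changes neither residues `b - a`, nor hook
lengths, nor the reading order of ladders. -/

namespace LadderCrystal

/-- Number of boxes of `μ` strictly to the right of the box `x` of `μ`. -/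
def arm (μ : YoungDiagram) (x : ℕ × ℕ) : ℕ := μ.rowLen x.1 - (x.2 + 1)

/-- Number of boxes of `μ` strictly below the box `x` of `μ`. -/
def leg (μ : YoungDiagram) (x : ℕ × ℕ) : ℕ := μ.colLen x.2 - (x.1 + 1)

/-- Hook length of the box `x` of `μ`. -/
def hookLength (μ : YoungDiagram) (x : ℕ × ℕ) : ℕ := arm μ x + leg μ x + 1

/-- `μ` is an `(ℓ,0)`-JM partition: there are no boxes `(a,b)`, `(a,y)`, `(x,b)` of `μ` such that
`ℓ` divides the hook length of `(a,b)` and divides neither that of `(a,y)` nor that of `(x,b)`. -/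
def IsJM (ℓ : ℕ) (μ : YoungDiagram) : Prop :=
  ¬ ∃ a b x y : ℕ, (a, b) ∈ μ ∧ (a, y) ∈ μ ∧ (x, b) ∈ μ ∧
    ℓ ∣ hookLength μ (a, b) ∧ ¬ ℓ ∣ hookLength μ (a, y) ∧ ¬ ℓ ∣ hookLength μ (x, b)

/-- The residue (column minus row, modulo `ℓ`) of a position. -/
def residue (ℓ : ℕ) (x : ℕ × ℕ) : ZMod ℓ := (x.2 : ZMod ℓ) - (x.1 : ZMod ℓ)

/-- A space not in `μ` whose addition gives the diagram of a partition. -/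
def IsAddable (μ : YoungDiagram) (x : ℕ × ℕ) : Prop :=
  x ∉ μ ∧ IsLowerSet (↑(insert x μ.cells) : Set (ℕ × ℕ))

/-- A box of `μ` whose removal leaves the diagram of a partition. -/
def IsRemovable (μ : YoungDiagram) (x : ℕ × ℕ) : Prop :=
  x ∈ μ ∧ IsLowerSet (↑(μ.cells.erase x) : Set (ℕ × ℕ))

/-- The positions `(a, b)` of the ladder through `(k, 0)`, those with `a + (ℓ - 1) b = k`, listed
from top to bottom (by increasing row `a`). The ladder of `k` is to the left of that of `k + 1`. -/
def ladder (ℓ k : ℕ) : List (ℕ × ℕ) :=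
  (List.range (k + 1) ×ˢ List.range (k + 1)).filter fun x => x.1 + (ℓ - 1) * x.2 = k

/-- The letters of a signature: `plus` for addable, `minus` for removable boxes. -/
inductive Sign : Type
  | plus
  | minus
  deriving DecidableEq

open Classical in
/-- The letter, labelled by its box, that the position `x` contributes to the `i`-signature. -/
noncomputable def letter (ℓ : ℕ) (i : ZMod ℓ) (μ : YoungDiagram) (x : ℕ × ℕ) :
    Option (Sign × (ℕ × ℕ)) :=
  if residue ℓ x = i ∧ IsAddable μ x then some (Sign.plus, x)
  else if residue ℓ x = i ∧ IsRemovable μ x then some (Sign.minus, x)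
  else none

/-- The ladder `i`-signature of `μ`: ladders are read from left to right and each ladder from top
to bottom. All addable and removable boxes lie on the ladders `k < ℓ * (μ.card + 1)`, see
`mem_signature`. -/
noncomputable def signature (ℓ : ℕ) (i : ZMod ℓ) (μ : YoungDiagram) : List (Sign × (ℕ × ℕ)) :=
  (List.range (ℓ * (μ.card + 1))).flatMap fun k => (ladder ℓ k).filterMap (letter ℓ i μ)

/-- Put one letter in front of a word in which all adjacent pairs `- +` have been cancelled, and
cancel the adjacent pair `- +` that this may create. -/
def consCancel (s : Sign × (ℕ × ℕ)) : List (Sign × (ℕ × ℕ)) → List (Sign × (ℕ × ℕ))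
  | [] => [s]
  | t :: w => if s.1 = Sign.minus ∧ t.1 = Sign.plus then w else s :: t :: w

/-- Cancel adjacent pairs `- +` until none is left. -/
def reduceWord (w : List (Sign × (ℕ × ℕ))) : List (Sign × (ℕ × ℕ)) := w.foldr consCancel []

/-- The reduced ladder `i`-signature of `μ`, a word of the form `+ … + - … -`. -/
noncomputable def reducedSignature (ℓ : ℕ) (i : ZMod ℓ) (μ : YoungDiagram) :
    List (Sign × (ℕ × ℕ)) := reduceWord (signature ℓ i μ)

/-- The ladder conormal `i`-boxes of `μ`, in the order of the reduced signature. -/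
noncomputable def conormalBoxes (ℓ : ℕ) (i : ZMod ℓ) (μ : YoungDiagram) : List (ℕ × ℕ) :=
  ((reducedSignature ℓ i μ).filter fun s => s.1 = Sign.plus).map Prod.snd

/-- The ladder cogood `i`-box of `μ` (the box of the rightmost `+`), if there is one. -/
noncomputable def cogoodBox (ℓ : ℕ) (i : ZMod ℓ) (μ : YoungDiagram) : Option (ℕ × ℕ) :=
  (conormalBoxes ℓ i μ).getLast?

theorem consCancel_sublist (s : Sign × (ℕ × ℕ)) (w : List (Sign × (ℕ × ℕ))) :
    (consCancel s w).Sublist (s :: w) := by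
  cases w with
  | nil => exact List.Sublist.refl _
  | cons t w =>
    simp only [consCancel]
    split_ifs
    · exact ((List.sublist_cons_self t w).trans (List.sublist_cons_self s _))
    · exact List.Sublist.refl _

theorem reduceWord_sublist (w : List (Sign × (ℕ × ℕ))) : (reduceWord w).Sublist w := by
  induction w with
  | nil => exact List.Sublist.refl _
  | cons s w ih => exact (consCancel_sublist s _).trans (ih.cons_cons s)

theorem letter_eq_some {ℓ : ℕ} {i : ZMod ℓ} {μ : YoungDiagram} {x y : ℕ × ℕ} {s : Sign} :
    letter ℓ i μ x = some (s, y) ↔ x = y ∧ residue ℓ y = i ∧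
      ((s = Sign.plus ∧ IsAddable μ y) ∨ (s = Sign.minus ∧ IsRemovable μ y)) := by
  have hdisj : ¬ (IsAddable μ x ∧ IsRemovable μ x) := fun h => h.1.1 h.2.1
  unfold letter
  split_ifs with h1 h2
  · constructor
    · rintro h
      obtain ⟨rfl, rfl⟩ := Prod.mk.inj (Option.some.inj h)
      exact ⟨rfl, h1.1, Or.inl ⟨rfl, h1.2⟩⟩
    · rintro ⟨rfl, -, ⟨rfl, -⟩ | ⟨rfl, h⟩⟩
      · rfl
      · exact absurd ⟨h1.2, h⟩ hdisj
  · constructor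
    · rintro h
      obtain ⟨rfl, rfl⟩ := Prod.mk.inj (Option.some.inj h)
      exact ⟨rfl, h2.1, Or.inr ⟨rfl, h2.2⟩⟩
    · rintro ⟨rfl, -, ⟨rfl, h⟩ | ⟨rfl, h⟩⟩
      · exact absurd ⟨h, h2.2⟩ hdisj
      · rfl
  · constructor
    · rintro h
      exact absurd h (by simp)
    · rintro ⟨rfl, h, ⟨rfl, h'⟩ | ⟨rfl, h'⟩⟩
      · exact absurd ⟨h, h'⟩ h1
      · exact absurd ⟨h, h'⟩ h2

theorem rowLen_le_card (μ : YoungDiagram) (a : ℕ) : μ.rowLen a ≤ μ.card := by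
  rw [YoungDiagram.rowLen_eq_card]
  exact Finset.card_le_card (Finset.filter_subset _ _)

theorem colLen_le_card (μ : YoungDiagram) (b : ℕ) : μ.colLen b ≤ μ.card := by
  rw [YoungDiagram.colLen_eq_card]
  exact Finset.card_le_card (Finset.filter_subset _ _)

theorem box_le_card {μ : YoungDiagram} {x : ℕ × ℕ} (h : x ∈ μ) :
    x.1 < μ.card ∧ x.2 < μ.card :=
  ⟨(YoungDiagram.mem_iff_lt_colLen.1 h).trans_le (colLen_le_card μ _),
    (YoungDiagram.mem_iff_lt_rowLen.1 h).trans_le (rowLen_le_card μ _)⟩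

theorem addable_le_card {μ : YoungDiagram} {x : ℕ × ℕ} (h : IsAddable μ x) :
    x.1 ≤ μ.card ∧ x.2 ≤ μ.card := by
  obtain ⟨a, b⟩ := x
  constructor
  · rcases a with _ | a
    · exact Nat.zero_le _
    · have hm : ((a, b) : ℕ × ℕ) ∈ (↑(insert (a + 1, b) μ.cells) : Set (ℕ × ℕ)) :=
        h.2 (show ((a, b) : ℕ × ℕ) ≤ (a + 1, b) from ⟨Nat.le_succ a, le_rfl⟩) (by simp)
      have hm' : ((a, b) : ℕ × ℕ) ∈ μ := by simpa using hm
      exact (box_le_card hm').1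
  · rcases b with _ | b
    · exact Nat.zero_le _
    · have hm : ((a, b) : ℕ × ℕ) ∈ (↑(insert (a, b + 1) μ.cells) : Set (ℕ × ℕ)) :=
        h.2 (show ((a, b) : ℕ × ℕ) ≤ (a, b + 1) from ⟨le_rfl, Nat.le_succ b⟩) (by simp)
      have hm' : ((a, b) : ℕ × ℕ) ∈ μ := by simpa using hm
      exact (box_le_card hm').2

/-- Every letter of the signature comes from an addable or removable `i`-box. -/
theorem of_mem_signature {ℓ : ℕ} {i : ZMod ℓ} {μ : YoungDiagram} {x : ℕ × ℕ} {s : Sign}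
    (h : (s, x) ∈ signature ℓ i μ) : residue ℓ x = i ∧
      ((s = Sign.plus ∧ IsAddable μ x) ∨ (s = Sign.minus ∧ IsRemovable μ x)) := by
  obtain ⟨k, -, hk⟩ := List.mem_flatMap.1 h
  obtain ⟨y, -, hy⟩ := List.mem_filterMap.1 hk
  exact (letter_eq_some.1 hy).2

/-- The signature contains all addable and all removable `i`-boxes. -/
theorem mem_signature {ℓ : ℕ} (hℓ : 2 ≤ ℓ) {i : ZMod ℓ} {μ : YoungDiagram} {x : ℕ × ℕ} {s : Sign} :
    (s, x) ∈ signature ℓ i μ ↔ residue ℓ x = i ∧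
      ((s = Sign.plus ∧ IsAddable μ x) ∨ (s = Sign.minus ∧ IsRemovable μ x)) := by
  refine ⟨of_mem_signature, fun h => ?_⟩
  have hx : x.1 ≤ μ.card ∧ x.2 ≤ μ.card := by
    rcases h.2 with h' | h'
    · exact addable_le_card h'.2
    · exact ⟨(box_le_card h'.2.1).1.le, (box_le_card h'.2.1).2.le⟩
  obtain ⟨m, rfl⟩ : ∃ m, ℓ = m + 2 := ⟨ℓ - 2, by omega⟩
  have h2 : (m + 2 - 1) * x.2 = m * x.2 + x.2 := by
    rw [show m + 2 - 1 = m + 1 from rfl, Nat.succ_mul]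
  have h3 : m * x.2 ≤ m * μ.card := Nat.mul_le_mul_left _ hx.2
  refine List.mem_flatMap.2 ⟨x.1 + (m + 2 - 1) * x.2, ?_, List.mem_filterMap.2 ⟨x, ?_, ?_⟩⟩
  · rw [List.mem_range]
    nlinarith
  · refine List.mem_filter.2 ⟨?_, by simp⟩
    refine List.pair_mem_product.2 ⟨List.mem_range.2 ?_, List.mem_range.2 ?_⟩ <;> omega
  · exact letter_eq_some.2 ⟨rfl, h⟩

theorem isAddable_of_cogoodBox {ℓ : ℕ} {i : ZMod ℓ} {μ : YoungDiagram} {x : ℕ × ℕ}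
    (h : cogoodBox ℓ i μ = some x) : IsAddable μ x := by
  obtain ⟨⟨s, y⟩, hs, rfl⟩ := List.mem_map.1 (List.mem_of_getLast? h)
  obtain ⟨hs1, hs2⟩ := List.mem_filter.1 hs
  have hs3 : s = Sign.plus := by simpa using hs2
  rcases (of_mem_signature ((reduceWord_sublist _).subset hs1)).2 with h' | h'
  · exact h'.2
  · exact absurd (hs3.symm.trans h'.1) (by decide)

/-- The diagram `μ ∪ {x}` for an addable box `x`. -/
def addBox (μ : YoungDiagram) (x : ℕ × ℕ) (hx : IsAddable μ x) : YoungDiagram where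
  cells := insert x μ.cells
  isLowerSet := hx.2

/-- The ladder crystal operator `f̂ᵢ`: add the ladder cogood `i`-box, if there is one; the value
`none` is the `0` of the crystal. -/
noncomputable def fHat (ℓ : ℕ) (i : ZMod ℓ) (μ : YoungDiagram) : Option YoungDiagram :=
  (cogoodBox ℓ i μ).pmap (fun x hx => addBox μ x hx) fun _ hx => isAddable_of_cogoodBox hx

/-- The nodes of the ladder crystal `B(Λ₀)ᴸ`: the partitions obtained from the empty partition by
applying the operators `f̂ᵢ`, for residues `i` modulo `ℓ`. -/
inductive IsNode (ℓ : ℕ) : YoungDiagram → Prop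
  | empty : IsNode ℓ ⊥
  | step {μ ν : YoungDiagram} (i : ZMod ℓ) : IsNode ℓ μ → fHat ℓ i μ = some ν → IsNode ℓ ν

end LadderCrystal

namespace LadderCrystal

/-! Induct on the number of boxes. Choose a residue `i` having a removable box and strip off all
removable `i`-boxes at once. Two facts about a JM partition `μ` make this work.

First, every addable `i`-box precedes every removable `i`-box (`IsJM.sortedSignature`), so nothing
cancels in the signature. Removing the first removable `i`-box makes it the last addable one, hence
cogood, and keeps the signature sorted. Repeating this, `μ` is reached from its stripped diagram by
powers of the operator for `i` (`isNode_of_strip`).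

Second, the stripped diagram is again JM (`IsJM.strip`).

Both facts are read off the Maya diagram: boxes are pairs gap < bead and hook lengths are the
differences. The JM condition says that if a bead `p` and a gap `q < p` are congruent modulo `ℓ`,
then all gaps below `p` or all beads above `q` lie in that class. Sortedness follows because
congruent gaps or beads are at least `ℓ` apart; stripping pushes beads of class `i` one step down
into free places. -/

/-! ### Reading order and sorted signatures -/

/-- The reading order of positions: ladders from left to right, each from top to bottom. -/
def Precedes (ℓ : ℕ) (x y : ℕ × ℕ) : Prop :=
  x.1 + (ℓ - 1) * x.2 < y.1 + (ℓ - 1) * y.2 ∨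
    (x.1 + (ℓ - 1) * x.2 = y.1 + (ℓ - 1) * y.2 ∧ x.1 < y.1)

theorem Precedes.trans {ℓ : ℕ} {x y z : ℕ × ℕ} (h : Precedes ℓ x y) (h' : Precedes ℓ y z) :
    Precedes ℓ x z := by
  unfold Precedes at *
  omega

theorem Precedes.irrefl {ℓ : ℕ} (x : ℕ × ℕ) : ¬ Precedes ℓ x x := by
  unfold Precedes
  omega

theorem precedes_trichotomy {ℓ : ℕ} (hℓ : 2 ≤ ℓ) (x y : ℕ × ℕ) :
    Precedes ℓ x y ∨ x = y ∨ Precedes ℓ y x := by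
  unfold Precedes
  rcases lt_trichotomy (x.1 + (ℓ - 1) * x.2) (y.1 + (ℓ - 1) * y.2) with h | h | h
  · exact Or.inl (Or.inl h)
  · rcases lt_trichotomy x.1 y.1 with h' | h' | h'
    · exact Or.inl (Or.inr ⟨h, h'⟩)
    · right; left
      rw [h', Nat.add_left_cancel_iff] at h
      exact Prod.ext h' (Nat.eq_of_mul_eq_mul_left (by omega) h)
    · exact Or.inr (Or.inr (Or.inr ⟨h.symm, h'⟩))
  · exact Or.inr (Or.inr (Or.inl h))

theorem mem_ladder {ℓ k : ℕ} {x : ℕ × ℕ} (h : x ∈ ladder ℓ k) : x.1 + (ℓ - 1) * x.2 = k := by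
  simpa using (List.mem_filter.1 h).2

theorem pairwise_product_range (m n : ℕ) :
    (List.range m ×ˢ List.range n).Pairwise
      fun x y => x.1 < y.1 ∨ (x.1 = y.1 ∧ x.2 < y.2) := by
  show List.Pairwise _ ((List.range m).flatMap fun a => (List.range n).map (Prod.mk a))
  rw [List.pairwise_flatMap]
  constructor
  · intro a _
    rw [List.pairwise_map]
    exact List.pairwise_lt_range.imp fun h => Or.inr ⟨rfl, h⟩
  · refine List.pairwise_lt_range.imp fun {a b} h x hx y hy => ?_
    obtain ⟨c, -, rfl⟩ := List.mem_map.1 hx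
    obtain ⟨d, -, rfl⟩ := List.mem_map.1 hy
    exact Or.inl h

theorem pairwise_ladder {ℓ : ℕ} (hℓ : 2 ≤ ℓ) (k : ℕ) : (ladder ℓ k).Pairwise (Precedes ℓ) := by
  have h := (pairwise_product_range (k + 1) (k + 1)).filter
    fun x : ℕ × ℕ => decide (x.1 + (ℓ - 1) * x.2 = k)
  refine List.Pairwise.imp_of_mem (fun {x y} hx hy hxy => ?_) h
  have hx' := mem_ladder hx
  have hy' := mem_ladder hy
  refine Or.inr ⟨hx'.trans hy'.symm, ?_⟩
  rcases hxy with hxy | ⟨h1, h2⟩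
  · exact hxy
  · have := Nat.mul_lt_mul_of_pos_left h2 (show 0 < ℓ - 1 by omega)
    omega

theorem pairwise_signature {ℓ : ℕ} (hℓ : 2 ≤ ℓ) (i : ZMod ℓ) (μ : YoungDiagram) :
    (signature ℓ i μ).Pairwise fun s t => Precedes ℓ s.2 t.2 := by
  unfold signature
  have key : ∀ (x : ℕ × ℕ) (s : Sign × (ℕ × ℕ)), letter ℓ i μ x = some s → s.2 = x :=
    fun x s h => (letter_eq_some.1 (show letter ℓ i μ x = some (s.1, s.2) from h)).1.symm
  rw [List.pairwise_flatMap]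
  constructor
  · intro k _
    rw [List.pairwise_filterMap]
    refine (pairwise_ladder hℓ k).imp fun {x y} hxy s hs t ht => ?_
    rw [key _ _ hs, key _ _ ht]
    exact hxy
  · refine List.pairwise_lt_range.imp fun {j k} h s hs t ht => ?_
    obtain ⟨x, hx, hs⟩ := List.mem_filterMap.1 hs
    obtain ⟨y, hy, ht⟩ := List.mem_filterMap.1 ht
    rw [key _ _ hs, key _ _ ht]
    left
    rw [mem_ladder hx, mem_ladder hy]
    exact h

theorem reduceWord_eq_self {w : List (Sign × (ℕ × ℕ))}
    (h : w.Pairwise fun s t => ¬ (s.1 = Sign.minus ∧ t.1 = Sign.plus)) : reduceWord w = w := by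
  induction w with
  | nil => rfl
  | cons s w ih =>
    rw [List.pairwise_cons] at h
    show consCancel s (reduceWord w) = s :: w
    rw [ih h.2]
    cases w with
    | nil => rfl
    | cons t w =>
      simp only [consCancel]
      rw [if_neg (h.1 t List.mem_cons_self)]

theorem getLast?_eq_some_of_pairwise {α : Type*} {r : α → α → Prop} {w : List α} {x : α}
    (hw : w.Pairwise r) (hx : x ∈ w) (h : ∀ y ∈ w, ¬ r x y) : w.getLast? = some x := by
  induction w with
  | nil => simp at hx
  | cons a w ih =>
    rw [List.pairwise_cons] at hw
    rcases List.mem_cons.1 hx with rfl | hx'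
    · cases w with
      | nil => rfl
      | cons b w => exact absurd (hw.1 b List.mem_cons_self) (h b (by simp))
    · rw [List.getLast?_cons, ih hw.2 hx' fun y hy => h y (List.mem_cons_of_mem _ hy)]
      rfl

/-- Every addable `i`-box of `μ` comes before every removable `i`-box: the `i`-signature is of the
form `+ … + - … -` already before cancelling. -/
def SortedSignature (ℓ : ℕ) (i : ZMod ℓ) (μ : YoungDiagram) : Prop :=
  ∀ x y, IsAddable μ x → residue ℓ x = i → IsRemovable μ y → residue ℓ y = i → Precedes ℓ x y

theorem cogoodBox_eq_some {ℓ : ℕ} (hℓ : 2 ≤ ℓ) {i : ZMod ℓ} {μ : YoungDiagram}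
    (hμ : SortedSignature ℓ i μ) {x : ℕ × ℕ} (hx : IsAddable μ x) (hxi : residue ℓ x = i)
    (hlast : ∀ y, IsAddable μ y → residue ℓ y = i → ¬ Precedes ℓ x y) :
    cogoodBox ℓ i μ = some x := by
  have hred : reducedSignature ℓ i μ = signature ℓ i μ := by
    refine reduceWord_eq_self
      (List.Pairwise.imp_of_mem (fun {s t} hs ht hst hc => ?_) (pairwise_signature hℓ i μ))
    obtain ⟨s, y⟩ := s
    obtain ⟨t, z⟩ := t
    obtain ⟨rfl, rfl⟩ : s = Sign.minus ∧ t = Sign.plus := hc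
    obtain ⟨hyi, hy⟩ := of_mem_signature hs
    obtain ⟨hzi, hz⟩ := of_mem_signature ht
    have hy' : IsRemovable μ y := by simpa using hy
    have hz' : IsAddable μ z := by simpa using hz
    exact Precedes.irrefl _ (hst.trans (hμ z y hz' hzi hy' hyi))
  unfold cogoodBox conormalBoxes
  rw [hred]
  refine getLast?_eq_some_of_pairwise (r := Precedes ℓ) ?_ ?_ ?_
  · rw [List.pairwise_map]
    exact (pairwise_signature hℓ i μ).filter _
  · refine List.mem_map.2 ⟨(Sign.plus, x), List.mem_filter.2 ⟨?_, by simp⟩, rfl⟩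
    exact (mem_signature hℓ).2 ⟨hxi, Or.inl ⟨rfl, hx⟩⟩
  · intro y hy
    obtain ⟨⟨s, y⟩, hs, rfl⟩ := List.mem_map.1 hy
    obtain ⟨hs1, hs2⟩ := List.mem_filter.1 hs
    obtain rfl : s = Sign.plus := by simpa using hs2
    obtain ⟨hyi, hy⟩ := of_mem_signature hs1
    exact hlast y (by simpa using hy) hyi

theorem fHat_eq_some {ℓ : ℕ} {i : ZMod ℓ} {μ ν : YoungDiagram} {x : ℕ × ℕ}
    (h : cogoodBox ℓ i μ = some x) (hν : ν.cells = insert x μ.cells) : fHat ℓ i μ = some ν := by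
  unfold fHat
  rw [Option.pmap_eq_some_iff]
  exact ⟨x, isAddable_of_cogoodBox h, h, YoungDiagram.ext hν⟩

/-! ### Removable and addable boxes, and stripping a residue -/

theorem IsRemovable.eq_of_le {μ : YoungDiagram} {x y : ℕ × ℕ} (hx : IsRemovable μ x) (hy : y ∈ μ)
    (hxy : x ≤ y) : y = x := by
  by_contra hne
  have h : x ∈ (↑(μ.cells.erase x) : Set (ℕ × ℕ)) := hx.2 hxy (by simp [hne, hy])
  simp at h

theorem isRemovable_iff {μ : YoungDiagram} {x : ℕ × ℕ} :
    IsRemovable μ x ↔ x ∈ μ ∧ (x.1 + 1, x.2) ∉ μ ∧ (x.1, x.2 + 1) ∉ μ := by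
  constructor
  · refine fun h => ⟨h.1, fun h' => ?_, fun h' => ?_⟩
    · have := h.eq_of_le h' ⟨Nat.le_succ _, le_rfl⟩
      simp [Prod.ext_iff] at this
    · have := h.eq_of_le h' ⟨le_rfl, Nat.le_succ _⟩
      simp [Prod.ext_iff] at this
  · rintro ⟨h1, h2, h3⟩
    refine ⟨h1, fun y z hzy hy => ?_⟩
    simp only [Finset.coe_erase, Set.mem_sdiff, Finset.mem_coe, Set.mem_singleton_iff,
      YoungDiagram.mem_cells] at hy ⊢
    refine ⟨μ.isLowerSet hzy hy.1, ?_⟩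
    rintro rfl
    obtain ⟨a, b⟩ := z
    obtain ⟨c, d⟩ := y
    obtain ⟨hac, hbd⟩ : a ≤ c ∧ b ≤ d := hzy
    rcases hac.lt_or_eq with h | rfl
    · exact h2 (μ.isLowerSet (show ((a + 1, b) : ℕ × ℕ) ≤ (c, d) from ⟨h, hbd⟩) hy.1)
    · rcases hbd.lt_or_eq with h | rfl
      · exact h3 (μ.isLowerSet (show ((a, b + 1) : ℕ × ℕ) ≤ (a, d) from ⟨le_rfl, h⟩) hy.1)
      · exact hy.2 rfl

theorem isAddable_iff {μ : YoungDiagram} {x : ℕ × ℕ} :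
    IsAddable μ x ↔ x ∉ μ ∧ ∀ y, y ≤ x → y ≠ x → y ∈ μ := by
  constructor
  · refine fun h => ⟨h.1, fun y hy hne => ?_⟩
    have := h.2 hy (by simp : x ∈ (↑(insert x μ.cells) : Set (ℕ × ℕ)))
    simpa [hne] using this
  · rintro ⟨h1, h2⟩
    refine ⟨h1, fun y z hzy hy => ?_⟩
    simp only [Finset.coe_insert, Set.mem_insert_iff, Finset.mem_coe,
      YoungDiagram.mem_cells] at hy ⊢
    by_cases hz : z = x
    · exact Or.inl hz
    · right
      rcases hy with rfl | hy
      · exact h2 z hzy hz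
      · exact μ.isLowerSet hzy hy

theorem residue_succ_fst_ne {ℓ : ℕ} (hℓ : 2 ≤ ℓ) (a b : ℕ) :
    residue ℓ (a + 1, b) ≠ residue ℓ (a, b) := by
  have : Fact (1 < ℓ) := ⟨hℓ⟩
  intro h
  simp [residue] at h

theorem residue_succ_snd_ne {ℓ : ℕ} (hℓ : 2 ≤ ℓ) (a b : ℕ) :
    residue ℓ (a, b + 1) ≠ residue ℓ (a, b) := by
  have : Fact (1 < ℓ) := ⟨hℓ⟩
  intro h
  simp [residue] at h

/-- The diagram `μ` without the removable box `x`. -/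
def removeBox (μ : YoungDiagram) (x : ℕ × ℕ) (hx : IsRemovable μ x) : YoungDiagram where
  cells := μ.cells.erase x
  isLowerSet := hx.2

theorem mem_removeBox {μ : YoungDiagram} {x y : ℕ × ℕ} {hx : IsRemovable μ x} :
    y ∈ removeBox μ x hx ↔ y ≠ x ∧ y ∈ μ := by
  rw [← YoungDiagram.mem_cells]
  exact Finset.mem_erase

theorem isAddable_removeBox_self {μ : YoungDiagram} {x : ℕ × ℕ} (hx : IsRemovable μ x) :
    IsAddable (removeBox μ x hx) x :=
  isAddable_iff.2 ⟨fun h => (mem_removeBox.1 h).1 rfl,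
    fun _ hy hne => mem_removeBox.2 ⟨hne, μ.isLowerSet hy hx.1⟩⟩

theorem IsAddable.of_removeBox {μ : YoungDiagram} {x y : ℕ × ℕ} {hx : IsRemovable μ x}
    (hy : IsAddable (removeBox μ x hx) y) (hne : y ≠ x) : IsAddable μ y := by
  rw [isAddable_iff] at hy ⊢
  exact ⟨fun h => hy.1 (mem_removeBox.2 ⟨hne, h⟩),
    fun z hz hzy => (mem_removeBox.1 (hy.2 z hz hzy)).2⟩

/-- Only the left and upper neighbours of `x` can become removable when `x` goes, and their residues
differ from that of `x`. -/
theorem isRemovable_removeBox_iff {ℓ : ℕ} (hℓ : 2 ≤ ℓ) {μ : YoungDiagram} {x y : ℕ × ℕ}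
    {hx : IsRemovable μ x} (hxy : residue ℓ y = residue ℓ x) :
    IsRemovable (removeBox μ x hx) y ↔ y ≠ x ∧ IsRemovable μ y := by
  have h1 : (y.1 + 1, y.2) ≠ x := fun h => residue_succ_fst_ne hℓ y.1 y.2 (by rw [h, ← hxy])
  have h2 : (y.1, y.2 + 1) ≠ x := fun h => residue_succ_snd_ne hℓ y.1 y.2 (by rw [h, ← hxy])
  simp only [isRemovable_iff, mem_removeBox]
  tauto

open Classical in
/-- The diagram `μ` without all its removable `i`-boxes. -/
noncomputable def strip (ℓ : ℕ) (i : ZMod ℓ) (μ : YoungDiagram) : YoungDiagram where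
  cells := μ.cells.filter fun x => ¬ (IsRemovable μ x ∧ residue ℓ x = i)
  isLowerSet := by
    intro x y hyx hx
    simp only [Finset.coe_filter, Set.mem_ofPred_eq, YoungDiagram.mem_cells] at hx ⊢
    refine ⟨μ.isLowerSet hyx hx.1, fun h => ?_⟩
    obtain rfl := h.1.eq_of_le hx.1 hyx
    exact hx.2 h

theorem mem_strip {ℓ : ℕ} {i : ZMod ℓ} {μ : YoungDiagram} {x : ℕ × ℕ} :
    x ∈ strip ℓ i μ ↔ x ∈ μ ∧ ¬ (IsRemovable μ x ∧ residue ℓ x = i) := by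
  classical
  rw [← YoungDiagram.mem_cells]
  exact Finset.mem_filter

theorem strip_removeBox {ℓ : ℕ} (hℓ : 2 ≤ ℓ) {μ : YoungDiagram} {x : ℕ × ℕ}
    (hx : IsRemovable μ x) :
    strip ℓ (residue ℓ x) (removeBox μ x hx) = strip ℓ (residue ℓ x) μ := by
  refine SetLike.ext fun y => ?_
  rw [mem_strip, mem_strip, mem_removeBox]
  by_cases hxy : residue ℓ y = residue ℓ x
  · rw [isRemovable_removeBox_iff hℓ hxy]
    by_cases h : y = x
    · subst h
      tauto
    · tauto
  · have : y ≠ x := fun h => hxy (by rw [h])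
    tauto

theorem exists_first {ℓ : ℕ} (hℓ : 2 ≤ ℓ) (s : Finset (ℕ × ℕ)) (hs : s.Nonempty) :
    ∃ x ∈ s, ∀ y ∈ s, y ≠ x → Precedes ℓ x y := by
  obtain ⟨x, hx, hmin⟩ := s.exists_min_image
    -- Reading order is the lexicographic order on (ladder, row).
    (fun x : ℕ × ℕ => (toLex (x.1 + (ℓ - 1) * x.2, x.1) : ℕ ×ₗ ℕ)) hs
  refine ⟨x, hx, fun y hy hne => ?_⟩
  rcases precedes_trichotomy hℓ x y with h | h | h
  · exact h
  · exact absurd h.symm hne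
  · exact absurd (hmin y hy) (not_le_of_gt (Prod.Lex.toLex_lt_toLex.2 h))

/-- Boxes are taken off in reading order, so that each is the last addable `i`-box at the moment it
has to be put back. -/
theorem isNode_of_strip {ℓ : ℕ} (hℓ : 2 ≤ ℓ) {i : ZMod ℓ} {μ : YoungDiagram}
    (hμ : SortedSignature ℓ i μ) (h : IsNode ℓ (strip ℓ i μ)) : IsNode ℓ μ := by
  classical
  induction hn : μ.card using Nat.strong_induction_on generalizing μ with
  | _ n ih =>
  subst hn
  set s := μ.cells.filter fun x => IsRemovable μ x ∧ residue ℓ x = i with hs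
  have mem_s : ∀ y, y ∈ s ↔ IsRemovable μ y ∧ residue ℓ y = i := fun y => by
    rw [hs, Finset.mem_filter]
    exact ⟨fun h => h.2, fun h => ⟨h.1.1, h⟩⟩
  rcases s.eq_empty_or_nonempty with h0 | h0
  · have : strip ℓ i μ = μ := SetLike.ext fun y => by
      rw [mem_strip, ← mem_s, h0]
      simp
    rwa [this] at h
  · obtain ⟨x, hxs, hfirst⟩ := exists_first hℓ s h0
    obtain ⟨hx, rfl⟩ := (mem_s x).1 hxs
    -- An addable box other than `x` was already addable in `μ`, so sortedness puts it before `x`.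
    have hlast : ∀ y, IsAddable (removeBox μ x hx) y → residue ℓ y = residue ℓ x → y ≠ x →
        Precedes ℓ y x := fun y hy hyi hne => hμ y x (hy.of_removeBox hne) hyi hx rfl
    have hsort : SortedSignature ℓ (residue ℓ x) (removeBox μ x hx) := by
      intro y z hy hyi hz hzi
      obtain ⟨hzx, hz'⟩ := (isRemovable_removeBox_iff hℓ hzi).1 hz
      have hxz := hfirst z ((mem_s z).2 ⟨hz', hzi⟩) hzx
      by_cases hyx : y = x
      · rwa [hyx]
      · exact (hlast y hy hyi hyx).trans hxz
    refine IsNode.step (residue ℓ x)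
      (ih (removeBox μ x hx).card (Finset.card_erase_lt_of_mem hx.1) hsort ?_ rfl)
      (fHat_eq_some (x := x) (cogoodBox_eq_some hℓ hsort (isAddable_removeBox_self hx) rfl ?_) ?_)
    · rwa [strip_removeBox hℓ hx]
    · intro y hy hyi hxy
      by_cases hyx : y = x
      · rw [hyx] at hxy
        exact Precedes.irrefl _ hxy
      · exact Precedes.irrefl _ (hxy.trans (hlast y hy hyi hyx))
    · exact (Finset.insert_erase hx.1).symm

/-! ### Maya diagrams and the JM condition -/

/-- The bead of row `a` in the Maya diagram of `μ`. -/
def rowBead (μ : YoungDiagram) (a : ℕ) : ℤ := μ.rowLen a - a - 1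

/-- The gap of column `b` in the Maya diagram of `μ`. -/
def colGap (μ : YoungDiagram) (b : ℕ) : ℤ := b - μ.colLen b

/-- The set of beads of the Maya diagram of `μ`. -/
def beads (μ : YoungDiagram) : Set ℤ := Set.range (rowBead μ)

theorem rowBead_mem (μ : YoungDiagram) (a : ℕ) : rowBead μ a ∈ beads μ := ⟨a, rfl⟩

theorem mem_iff_colGap_lt_rowBead {μ : YoungDiagram} {a b : ℕ} :
    (a, b) ∈ μ ↔ colGap μ b < rowBead μ a := by
  have h1 := YoungDiagram.mem_iff_lt_rowLen (μ := μ) (i := a) (j := b)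
  have h2 := YoungDiagram.mem_iff_lt_colLen (μ := μ) (i := a) (j := b)
  unfold colGap rowBead
  by_cases h : (a, b) ∈ μ
  · have := h1.1 h
    have := h2.1 h
    simp only [h, true_iff]
    omega
  · have := mt h1.2 h
    have := mt h2.2 h
    simp only [h, false_iff]
    omega

theorem colGap_notMem (μ : YoungDiagram) (b : ℕ) : colGap μ b ∉ beads μ := by
  rintro ⟨a, h⟩
  have h1 := YoungDiagram.mem_iff_lt_rowLen (μ := μ) (i := a) (j := b)
  have h2 := YoungDiagram.mem_iff_lt_colLen (μ := μ) (i := a) (j := b)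
  have h3 := mem_iff_colGap_lt_rowBead (μ := μ) (a := a) (b := b)
  rw [h2] at h1 h3
  unfold colGap rowBead at *
  omega

/-- With `colGap_notMem`, this shows that the column gaps are exactly the complement of the beads.
If `a` is the first row whose bead lies below `z`, the column is `z + a`, of length `a`. -/
theorem exists_colGap_eq {μ : YoungDiagram} {z : ℤ} (hz : z ∉ beads μ) : ∃ b, colGap μ b = z := by
  have hex : ∃ a, rowBead μ a < z := by
    -- No row is longer than `μ.card`, so the bead of this row is at most `-|z| - 1`.
    refine ⟨μ.card + z.natAbs, ?_⟩
    have := rowLen_le_card μ (μ.card + z.natAbs)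
    unfold rowBead
    omega
  classical
  obtain ⟨a, ha, hmin⟩ : ∃ a, rowBead μ a < z ∧ ∀ a' < a, ¬ rowBead μ a' < z :=
    ⟨Nat.find hex, Nat.find_spec hex, fun _ h => Nat.find_min hex h⟩
  have hpos : 0 ≤ z + a := by
    unfold rowBead at ha
    omega
  obtain ⟨b, hb⟩ := Int.eq_ofNat_of_zero_le hpos
  refine ⟨b, ?_⟩
  have h1 : ¬ a < μ.colLen b := by
    rw [← YoungDiagram.mem_iff_lt_colLen, YoungDiagram.mem_iff_lt_rowLen]
    unfold rowBead at ha
    omega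
  have h2 : a ≤ μ.colLen b := by
    rcases a with _ | a
    · exact Nat.zero_le _
    · have h3 := hmin a (Nat.lt_succ_self a)
      have h4 : rowBead μ a ≠ z := fun h => hz ⟨a, h⟩
      rw [Nat.succ_le_iff, ← YoungDiagram.mem_iff_lt_colLen, YoungDiagram.mem_iff_lt_rowLen]
      unfold rowBead at h3 h4
      omega
  unfold colGap
  omega

theorem hookLength_eq {μ : YoungDiagram} {a b : ℕ} (h : (a, b) ∈ μ) :
    (hookLength μ (a, b) : ℤ) = rowBead μ a - colGap μ b := by
  have h1 := YoungDiagram.mem_iff_lt_rowLen.1 h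
  have h2 := YoungDiagram.mem_iff_lt_colLen.1 h
  simp only [hookLength, arm, leg, rowBead, colGap]
  omega

theorem dvd_hookLength_iff {ℓ : ℕ} {μ : YoungDiagram} {a b : ℕ} (h : (a, b) ∈ μ) :
    ℓ ∣ hookLength μ (a, b) ↔ ((rowBead μ a : ℤ) : ZMod ℓ) = (colGap μ b : ℤ) := by
  rw [← Int.natCast_dvd_natCast, hookLength_eq h, eq_comm, ZMod.intCast_eq_intCast_iff_dvd_sub]

/-- The hook condition of `IsJM` on the Maya diagram with set of beads `X`. -/
def IsJMSet (ℓ : ℕ) (X : Set ℤ) : Prop :=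
  ∀ p ∈ X, ∀ q ∉ X, q < p → (p : ZMod ℓ) = q →
    (∀ g ∉ X, g < p → (g : ZMod ℓ) = p) ∨ (∀ e ∈ X, q < e → (e : ZMod ℓ) = q)

theorem isJM_iff {ℓ : ℕ} {μ : YoungDiagram} : IsJM ℓ μ ↔ IsJMSet ℓ (beads μ) := by
  constructor
  · rintro h _ ⟨a, rfl⟩ q hq hqp hpq
    obtain ⟨b, rfl⟩ := exists_colGap_eq hq
    by_contra! hcon
    obtain ⟨⟨g, hg, hgp, hgne⟩, ⟨e, ⟨x, rfl⟩, hqe, hene⟩⟩ := hcon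
    obtain ⟨y, rfl⟩ := exists_colGap_eq hg
    have h1 := mem_iff_colGap_lt_rowBead.2 hqp
    have h2 := mem_iff_colGap_lt_rowBead.2 hgp
    have h3 := mem_iff_colGap_lt_rowBead.2 hqe
    refine h ⟨a, b, x, y, h1, h2, h3, ?_, ?_, ?_⟩
    · rwa [dvd_hookLength_iff h1]
    · rw [dvd_hookLength_iff h2]
      exact fun h' => hgne h'.symm
    · rwa [dvd_hookLength_iff h3]
  · rintro h ⟨a, b, x, y, h1, h2, h3, h4, h5, h6⟩
    rw [dvd_hookLength_iff h1] at h4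
    rw [dvd_hookLength_iff h2] at h5
    rw [dvd_hookLength_iff h3] at h6
    rcases h _ (rowBead_mem μ a) _ (colGap_notMem μ b) (mem_iff_colGap_lt_rowBead.1 h1) h4
      with h' | h'
    · exact h5 (h' _ (colGap_notMem μ y) (mem_iff_colGap_lt_rowBead.1 h2)).symm
    · exact h6 (h' _ (rowBead_mem μ x) (mem_iff_colGap_lt_rowBead.1 h3))

theorem rowBead_strictAnti (μ : YoungDiagram) : StrictAnti (rowBead μ) :=
  strictAnti_nat_of_succ_lt fun a => by
    have := μ.rowLen_anti a (a + 1) (Nat.le_succ a)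
    unfold rowBead
    push_cast
    omega

theorem colGap_strictMono (μ : YoungDiagram) : StrictMono (colGap μ) :=
  strictMono_nat_of_lt_succ fun b => by
    have := μ.colLen_anti b (b + 1) (Nat.le_succ b)
    unfold colGap
    push_cast
    omega

theorem isRemovable_iff_rowLen {μ : YoungDiagram} {a b : ℕ} :
    IsRemovable μ (a, b) ↔ μ.rowLen a = b + 1 ∧ μ.rowLen (a + 1) < μ.rowLen a := by
  simp only [isRemovable_iff, YoungDiagram.mem_iff_lt_rowLen]
  omega

theorem IsRemovable.rowBead_eq {μ : YoungDiagram} {a b : ℕ} (h : IsRemovable μ (a, b)) :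
    rowBead μ a = b - a := by
  have := (isRemovable_iff_rowLen.1 h).1
  unfold rowBead
  omega

theorem IsRemovable.colGap_eq {μ : YoungDiagram} {a b : ℕ} (h : IsRemovable μ (a, b)) :
    colGap μ b = b - a - 1 := by
  obtain ⟨h1, h2, -⟩ := isRemovable_iff.1 h
  rw [YoungDiagram.mem_iff_lt_colLen] at h1 h2
  dsimp only at h2
  unfold colGap
  omega

theorem IsAddable.rowBead_eq {μ : YoungDiagram} {a b : ℕ} (h : IsAddable μ (a, b)) :
    rowBead μ a = b - a - 1 := by
  obtain ⟨h1, h2⟩ := isAddable_iff.1 h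
  have h3 : b ≤ μ.rowLen a := by
    rcases b with _ | b
    · exact Nat.zero_le _
    · exact YoungDiagram.mem_iff_lt_rowLen.1 (h2 (a, b) ⟨le_rfl, Nat.le_succ b⟩ (by simp))
  rw [YoungDiagram.mem_iff_lt_rowLen] at h1
  unfold rowBead
  omega

theorem IsAddable.colGap_eq {μ : YoungDiagram} {a b : ℕ} (h : IsAddable μ (a, b)) :
    colGap μ b = b - a := by
  obtain ⟨h1, h2⟩ := isAddable_iff.1 h
  have h3 : a ≤ μ.colLen b := by
    rcases a with _ | a
    · exact Nat.zero_le _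
    · exact YoungDiagram.mem_iff_lt_colLen.1 (h2 (a, b) ⟨Nat.le_succ a, le_rfl⟩ (by simp))
  rw [YoungDiagram.mem_iff_lt_colLen] at h1
  unfold colGap
  omega

/-- Distinct values in one class modulo `ℓ` differ by at least `ℓ`, and so does the last one from
`t`. Used for gaps of consecutive columns and, with signs reversed, for beads of consecutive rows.
-/
theorem add_mul_le_of_forall_dvd {ℓ : ℕ} {f : ℕ → ℤ} (hf : StrictMono f) {t : ℤ} (k m : ℕ)
    (h : ∀ j, m ≤ j → j ≤ m + k → f j < t ∧ (ℓ : ℤ) ∣ t - f j) : f m + ℓ * (k + 1) ≤ t := by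
  induction k generalizing m with
  | zero =>
    obtain ⟨h1, h2⟩ := h m le_rfl (by omega)
    have := Int.le_of_dvd (by omega) h2
    push_cast
    linarith
  | succ k ih =>
    have h1 := ih (m + 1) fun j hj hj' => h j (by omega) (by omega)
    have h2 := hf (Nat.lt_succ_self m)
    have h3 : (ℓ : ℤ) ∣ f (m + 1) - f m := by
      have := dvd_sub (h m le_rfl (by omega)).2 (h (m + 1) (by omega) (by omega)).2
      rwa [sub_sub_sub_cancel_left] at this
    have := Int.le_of_dvd (by simpa using h2) h3
    push_cast
    linarith

theorem intCast_sub_one_ne {ℓ : ℕ} (hℓ : 2 ≤ ℓ) (z : ℤ) : ((z - 1 : ℤ) : ZMod ℓ) ≠ (z : ℤ) := by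
  have : Fact (1 < ℓ) := ⟨hℓ⟩
  simp

theorem intCast_sub_one_eq {ℓ : ℕ} {y z : ℤ} (h : (y : ZMod ℓ) = z) :
    ((y - 1 : ℤ) : ZMod ℓ) = (z - 1 : ℤ) := by
  push_cast
  rw [h]

theorem residue_eq_intCast (ℓ a b : ℕ) : residue ℓ (a, b) = (((b : ℤ) - a : ℤ) : ZMod ℓ) := by
  simp [residue]

/-! ### JM partitions have sorted signatures -/

/-- A removable box of content `c` is a bead at `c` with a gap at `c - 1`; an addable box of content
`d` is a gap at `d` with a bead at `d - 1`. As `c ≡ d`, the JM condition applies to `d - 1`, `c - 1`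
if `c < d` and to `c`, `d` if `d < c`. One alternative always fails, since it would make
neighbouring positions congruent. -/
theorem IsJM.sortedSignature {ℓ : ℕ} (hℓ : 3 ≤ ℓ) {μ : YoungDiagram} (hμ : IsJM ℓ μ) (i : ZMod ℓ) :
    SortedSignature ℓ i μ := by
  rintro ⟨a', b'⟩ ⟨a, b⟩ hadd hadd_i hrem hrem_i
  rw [isJM_iff] at hμ
  rw [residue_eq_intCast] at hadd_i hrem_i
  have h2 : 2 ≤ ℓ := by omega
  have hcd := hrem_i.trans hadd_i.symm
  have rc := hrem.rowBead_eq
  have gc := hrem.colGap_eq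
  have rd := hadd.rowBead_eq
  have gd := hadd.colGap_eq
  have mc := rowBead_mem μ a
  have nc := colGap_notMem μ b
  have md := rowBead_mem μ a'
  have nd := colGap_notMem μ b'
  rw [rc] at mc
  rw [gc] at nc
  rw [rd] at md
  rw [gd] at nd
  have hcd1 := intCast_sub_one_eq hcd
  unfold Precedes
  obtain ⟨m, rfl⟩ : ∃ m, ℓ = m + 3 := ⟨ℓ - 3, by omega⟩
  simp only [show m + 3 - 1 = m + 2 from rfl]
  rcases lt_trichotomy ((b : ℤ) - a) (b' - a') with hlt | heq | hlt
  · rcases hμ _ md _ nc (by omega) hcd1.symm with h | h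
    · rcases le_or_gt b' b with hb | hb
      · left
        have := Nat.mul_le_mul_left (m + 2) hb
        omega
      · obtain ⟨k, rfl⟩ := Nat.exists_eq_add_of_lt hb
        -- The gaps of columns `b, …, b' - 1` all lie below the bead `d - 1`, hence in its class.
        -- This gives `a - a' ≥ (ℓ - 1)(b' - b)`.
        have key := add_mul_le_of_forall_dvd (ℓ := m + 3) (t := (b + k + 1 : ℕ) - a' - 1)
          (colGap_strictMono μ) k b fun j hj hj' => by
            have h3 := colGap_strictMono μ (show j < b + k + 1 by omega)
            have h4 : colGap μ j ≠ (b + k + 1 : ℕ) - a' - 1 := fun h' =>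
              colGap_notMem μ j (h' ▸ md)
            have h5 : colGap μ j < (b + k + 1 : ℕ) - a' - 1 := by omega
            exact ⟨h5, (ZMod.intCast_eq_intCast_iff_dvd_sub _ _ _).1
              (h _ (colGap_notMem μ j) h5)⟩
        rw [gc] at key
        push_cast at key
        zify
        rw [← sub_nonneg] at key
        -- Both boxes may lie on one ladder; the addable one is then higher, which is why ladders
        -- are read from top to bottom.
        by_cases hc : (a' : ℤ) + (m + 2) * (b + k + 1) = a + (m + 2) * b
        · right
          refine ⟨hc, ?_⟩
          nlinarith
        · left
          refine lt_of_le_of_ne ?_ hc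
          nlinarith
    · exact absurd (h _ mc (by omega)).symm (intCast_sub_one_ne h2 _)
  · rw [heq] at mc
    exact absurd mc nd
  · left
    rcases hμ _ mc _ nd (by omega) hcd with h | h
    · exact absurd (h _ nc (by omega)) (intCast_sub_one_ne h2 _)
    · rcases le_or_gt a' a with ha | ha
      · have hb : b' < b := by omega
        have := Nat.mul_lt_mul_of_pos_left hb (show 0 < m + 2 by omega)
        omega
      · obtain ⟨k, rfl⟩ := Nat.exists_eq_add_of_lt ha
        -- Conjugate argument: the beads of rows `a, …, a' - 1` lie above the gap `d`, so `b - b' ≥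
        -- (ℓ - 1)(a' - a)`.
        have key := add_mul_le_of_forall_dvd (ℓ := m + 3) (f := fun j => - rowBead μ j)
          (t := - (b' - (a + k + 1 : ℕ))) (rowBead_strictAnti μ).neg k a fun j hj hj' => by
            have h3 := rowBead_strictAnti μ (show j < a + k + 1 by omega)
            have h4 : rowBead μ j ≠ b' - (a + k + 1 : ℕ) := fun h' =>
              nd (h' ▸ rowBead_mem μ j)
            have h5 : b' - (a + k + 1 : ℕ) < rowBead μ j := by omega
            refine ⟨by omega, ?_⟩
            have := (ZMod.intCast_eq_intCast_iff_dvd_sub _ _ _).1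
              (h _ (rowBead_mem μ j) h5).symm
            rwa [neg_sub_neg]
        simp only [rc] at key
        push_cast at key
        zify
        have hb : (m + 2 : ℤ) * (k + 1) ≤ b - b' := by linarith
        have h3 := mul_le_mul_of_nonneg_left hb (show (0 : ℤ) ≤ m + 2 by omega)
        -- The second factor is `(ℓ - 1)² - 1`, which would vanish for `ℓ = 2`.
        have h4 : (0 : ℤ) < (k + 1) * (m ^ 2 + 4 * m + 3) := by positivity
        linarith

/-! ### Stripping as a push of beads -/

theorem rowBead_sub_one_mem_iff {μ : YoungDiagram} {a : ℕ} :
    rowBead μ a - 1 ∈ beads μ ↔ μ.rowLen (a + 1) = μ.rowLen a := by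
  constructor
  · rintro ⟨x, hx⟩
    have h1 : a < x := (rowBead_strictAnti μ).lt_iff_gt.1 (by omega)
    have h2 := (rowBead_strictAnti μ).antitone (show a + 1 ≤ x from h1)
    have h3 := μ.rowLen_anti a (a + 1) (Nat.le_succ a)
    unfold rowBead at *
    push_cast at h2
    omega
  · intro h
    refine ⟨a + 1, ?_⟩
    unfold rowBead
    push_cast
    omega

theorem rowBead_strip_of_sub_one_notMem {ℓ : ℕ} {μ : YoungDiagram} {a : ℕ}
    (h : rowBead μ a - 1 ∉ beads μ) :
    rowBead (strip ℓ ((rowBead μ a : ℤ) : ZMod ℓ) μ) a = rowBead μ a - 1 := by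
  rw [rowBead_sub_one_mem_iff] at h
  have h1 := μ.rowLen_anti a (a + 1) (Nat.le_succ a)
  obtain ⟨b, hb⟩ : ∃ b, μ.rowLen a = b + 1 := ⟨μ.rowLen a - 1, by omega⟩
  have hrem : IsRemovable μ (a, b) := isRemovable_iff_rowLen.2 ⟨hb, by omega⟩
  suffices (strip ℓ ((rowBead μ a : ℤ) : ZMod ℓ) μ).rowLen a = b by
    rw [hrem.rowBead_eq] at this ⊢
    rw [rowBead, this]
  refine eq_of_forall_lt_iff fun c => ?_
  rw [← YoungDiagram.mem_iff_lt_rowLen, mem_strip, YoungDiagram.mem_iff_lt_rowLen,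
    isRemovable_iff_rowLen, hb]
  constructor
  · rintro ⟨h2, h3⟩
    rcases (Nat.lt_succ_iff.1 h2).lt_or_eq with h4 | rfl
    · exact h4
    · exact absurd ⟨⟨rfl, by omega⟩, by rw [residue_eq_intCast, hrem.rowBead_eq]⟩ h3
  · exact fun h2 => ⟨by omega, by omega⟩

theorem rowBead_strip_of_not {ℓ : ℕ} {i : ZMod ℓ} {μ : YoungDiagram} {a : ℕ}
    (h : ¬ (((rowBead μ a : ℤ) : ZMod ℓ) = i ∧ rowBead μ a - 1 ∉ beads μ)) :
    rowBead (strip ℓ i μ) a = rowBead μ a := by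
  suffices (strip ℓ i μ).rowLen a = μ.rowLen a by
    unfold rowBead
    rw [this]
  refine eq_of_forall_lt_iff fun c => ?_
  rw [← YoungDiagram.mem_iff_lt_rowLen, mem_strip, YoungDiagram.mem_iff_lt_rowLen]
  refine and_iff_left fun hc => h ⟨?_, ?_⟩
  · rw [hc.1.rowBead_eq, ← residue_eq_intCast]
    exact hc.2
  · rw [rowBead_sub_one_mem_iff]
    exact (isRemovable_iff_rowLen.1 hc.1).2.ne

/-- Removing the end box of a row lowers its bead by one, and the row has a removable box exactly
when the place below its bead is free. -/
theorem mem_beads_strip {ℓ : ℕ} {i : ZMod ℓ} {μ : YoungDiagram} {z : ℤ} :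
    z ∈ beads (strip ℓ i μ) ↔
      (z ∈ beads μ ∧ ¬ ((z : ZMod ℓ) = i ∧ z - 1 ∉ beads μ)) ∨
      (z ∉ beads μ ∧ z + 1 ∈ beads μ ∧ ((z + 1 : ℤ) : ZMod ℓ) = i) := by
  constructor
  · rintro ⟨a, rfl⟩
    by_cases h : ((rowBead μ a : ℤ) : ZMod ℓ) = i ∧ rowBead μ a - 1 ∉ beads μ
    · obtain ⟨rfl, h⟩ := h
      rw [rowBead_strip_of_sub_one_notMem h]
      refine Or.inr ⟨h, ?_, ?_⟩ <;> rw [sub_add_cancel]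
      exact rowBead_mem μ a
    · rw [rowBead_strip_of_not h]
      exact Or.inl ⟨rowBead_mem μ a, h⟩
  · rintro (⟨⟨a, rfl⟩, h⟩ | ⟨h, ⟨a, ha⟩, rfl⟩)
    · exact ⟨a, rowBead_strip_of_not h⟩
    · obtain rfl : z = rowBead μ a - 1 := by omega
      rw [← ha]
      exact ⟨a, rowBead_strip_of_sub_one_notMem h⟩

/-- On each pair `z - 1, z` with `z ≡ i`, the upper place of `Y` is filled when both places of `X`
are, the lower one when at least one is; other classes are unchanged. The proof splits on the class
of the bead `p`, translating each hook back to a hook of `X`. -/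
theorem IsJMSet.of_push {ℓ : ℕ} (hℓ : 2 ≤ ℓ) {i : ZMod ℓ} {X Y : Set ℤ} (hX : IsJMSet ℓ X)
    (hY : ∀ z, z ∈ Y ↔ (z ∈ X ∧ ¬ ((z : ZMod ℓ) = i ∧ z - 1 ∉ X)) ∨
      (z ∉ X ∧ z + 1 ∈ X ∧ ((z + 1 : ℤ) : ZMod ℓ) = i)) : IsJMSet ℓ Y := by
  have hne := intCast_sub_one_ne hℓ
  have hne' : ∀ z : ℤ, ((z + 1 : ℤ) : ZMod ℓ) ≠ z := fun z h => hne (z + 1) (by simpa using h.symm)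
  have hi : ∀ z : ℤ, (z : ZMod ℓ) = i → (z ∈ Y ↔ z ∈ X ∧ z - 1 ∈ X) := fun z hz => by
    have : ((z + 1 : ℤ) : ZMod ℓ) ≠ i := fun h => hne' z (h.trans hz.symm)
    rw [hY]
    tauto
  have hj : ∀ z : ℤ, ((z + 1 : ℤ) : ZMod ℓ) = i → (z ∈ Y ↔ z ∈ X ∨ z + 1 ∈ X) := fun z hz => by
    have : (z : ZMod ℓ) ≠ i := fun h => hne' z (hz.trans h.symm)
    rw [hY]
    tauto
  have hk : ∀ z : ℤ, (z : ZMod ℓ) ≠ i → ((z + 1 : ℤ) : ZMod ℓ) ≠ i → (z ∈ Y ↔ z ∈ X) :=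
    fun z h1 h2 => by
      rw [hY]
      tauto
  have hsucc : ∀ {y z : ℤ}, (y : ZMod ℓ) = z → ((y + 1 : ℤ) : ZMod ℓ) = (z + 1 : ℤ) :=
    fun h => by push_cast; rw [h]
  have hpred : ∀ {y z : ℤ}, ((y + 1 : ℤ) : ZMod ℓ) = (z + 1 : ℤ) → (y : ZMod ℓ) = z :=
    fun h => by simpa using intCast_sub_one_eq h
  have hgap : ∀ g ∉ Y, (g : ZMod ℓ) ≠ i → g ∉ X := fun g hg h => by
    rw [hY] at hg
    tauto
  intro p hp q hq hqp hpq
  by_cases hpi : (p : ZMod ℓ) = i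
  · have hqi := hpq.symm.trans hpi
    rw [hi p hpi] at hp
    rw [hi q hqi] at hq
    have hqp1 : q ≠ p - 1 := by
      rintro rfl
      exact hne p hpq.symm
    left
    intro g hg hgp
    by_contra hgne
    have hgX := hgap g hg (fun h => hgne (h.trans hpi.symm))
    -- Both `p` and `p - 1` are beads of `X`, and `q` or `q - 1` is a gap. Use the hook on the pair
    -- shifted down by one if `q` is filled, and the hook on `p`, `q` otherwise.
    by_cases hqX : q ∈ X
    · rcases hX _ hp.2 (q - 1) (fun h => hq ⟨hqX, h⟩) (by omega) (intCast_sub_one_eq hpq)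
        with h | h
      · have hgp1 : g ≠ p - 1 := by
          rintro rfl
          exact hgX hp.2
        have hg1 := h g hgX (by omega)
        have hg2 : ((g + 1 : ℤ) : ZMod ℓ) = p := by simpa using hsucc hg1
        rw [hj g (hg2.trans hpi)] at hg
        push Not at hg
        have hg3 : g + 1 ≠ p - 1 := by
          intro h'
          rw [h'] at hg2
          exact hne p hg2
        exact hne p ((h (g + 1) hg.2 (by omega)).symm.trans hg2)
      · exact hne p ((intCast_sub_one_eq hpq).trans (h p hp.1 (by omega)).symm)
    · rcases hX p hp.1 q hqX hqp hpq with h | h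
      · exact hgne (h g hgX hgp)
      · exact hne p ((h _ hp.2 (by omega)).trans hpq.symm)
  · by_cases hpj : ((p + 1 : ℤ) : ZMod ℓ) = i
    · have hqj := (hsucc hpq).symm.trans hpj
      rw [hj p hpj] at hp
      rw [hj q hqj] at hq
      push Not at hq
      -- Mirror image of the previous case: `q` and `q + 1` are both gaps of `X`, and `p` or `p + 1`
      -- is a bead.
      right
      intro e he hqe
      by_cases heX : e ∈ X
      · rcases hp with hp | hp
        · rcases hX p hp q hq.1 hqp hpq with h | h
          · have hqp1 : q + 1 ≠ p := by
              rintro rfl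
              exact hne' q hpq
            exact absurd ((h _ hq.2 (by omega)).trans hpq) (hne' q)
          · exact h e heX hqe
        · rcases hX _ hp _ hq.2 (by omega) (hsucc hpq) with h | h
          · exact absurd ((h q hq.1 (by omega)).trans (hsucc hpq)).symm (hne' q)
          · have he1 : e ≠ q + 1 := by
              rintro rfl
              exact hq.2 heX
            have he2 := h e heX (by omega)
            have he3 := ((hi e (he2.trans hqj)).1 he).2
            have he4 : e - 1 ≠ q + 1 := fun h' => hq.2 (h' ▸ he3)
            exact absurd ((h _ he3 (by omega)).trans he2.symm) (hne e)
      · rw [hY] at he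
        have he1 : ((e + 1 : ℤ) : ZMod ℓ) = i := by tauto
        exact hpred (he1.trans hqj.symm)
    · rw [hk p hpi hpj] at hp
      rw [hk q (fun h => hpi (hpq.trans h)) (fun h => hpj ((hsucc hpq).trans h))] at hq
      -- Here `p` and `q` were not affected. A gap or bead created by the push comes from a
      -- neighbouring gap or bead of `X`, to which the alternative for `X` applies; that would put
      -- `p` in class `i - 1` or `i`, both excluded.
      rcases hX p hp q hq hqp hpq with h | h
      · left
        intro g hg hgp
        by_cases hgX : g ∈ X
        · have hgi : (g : ZMod ℓ) = i := by
            by_contra hgi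
            exact hgap g hg hgi hgX
          rw [hi g hgi] at hg
          have h1 := h (g - 1) (fun h' => hg ⟨hgX, h'⟩) (by omega)
          have h2 : (g : ZMod ℓ) = (p + 1 : ℤ) := by simpa using hsucc h1
          exact absurd (h2.symm.trans hgi) hpj
        · exact h g hgX hgp
      · right
        intro e he hqe
        by_cases heX : e ∈ X
        · exact h e heX hqe
        · rw [hY] at he
          obtain ⟨h1, h2⟩ : e + 1 ∈ X ∧ ((e + 1 : ℤ) : ZMod ℓ) = i := by tauto
          exact absurd (hpq.trans ((h _ h1 (by omega)).symm.trans h2)) hpi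

theorem IsJM.strip {ℓ : ℕ} (hℓ : 2 ≤ ℓ) {μ : YoungDiagram} (hμ : IsJM ℓ μ) (i : ZMod ℓ) :
    IsJM ℓ (strip ℓ i μ) :=
  isJM_iff.2 ((isJM_iff.1 hμ).of_push hℓ fun _ => mem_beads_strip)

/-! ### Conclusion -/

theorem exists_isRemovable {μ : YoungDiagram} (h : μ ≠ ⊥) : ∃ x, IsRemovable μ x := by
  have hne : μ.cells.Nonempty := by
    rw [Finset.nonempty_iff_ne_empty]
    exact fun h' => h (YoungDiagram.ext h')
  -- A box maximizing row plus column has no box to its right or below it.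
  obtain ⟨x, hx, hmax⟩ := μ.cells.exists_max_image (fun x => x.1 + x.2) hne
  refine ⟨x, isRemovable_iff.2 ⟨hx, fun h' => ?_, fun h' => ?_⟩⟩
  · have := hmax _ h'
    dsimp only at this
    omega
  · have := hmax _ h'
    dsimp only at this
    omega

end LadderCrystal

theorem mainTheorem6 (ℓ : ℕ) (hℓ : 3 ≤ ℓ) (μ : YoungDiagram)
    (hμ : LadderCrystal.IsJM ℓ μ) : LadderCrystal.IsNode ℓ μ := by
  induction hn : μ.card using Nat.strong_induction_on generalizing μ with
  | _ n ih =>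
  subst hn
  by_cases h : μ = ⊥
  · subst h
    exact LadderCrystal.IsNode.empty
  · obtain ⟨x, hx⟩ := LadderCrystal.exists_isRemovable h
    refine LadderCrystal.isNode_of_strip (by omega) (hμ.sortedSignature hℓ _)
      (ih _ ?_ _ (hμ.strip (by omega) (LadderCrystal.residue ℓ x)) rfl)
    refine Finset.card_lt_card ((Finset.ssubset_iff_of_subset fun y hy => ?_).2 ⟨x, hx.1, ?_⟩)
    · exact (LadderCrystal.mem_strip.1 hy).1
    · exact fun h' => (LadderCrystal.mem_strip.1 h').2 ⟨hx, rfl⟩
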